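/- Let $n\ge 1$ be an integer and let $\mathbb{S}^n=\{x\in\mathbb{R}^{n+1} : |x|=1\}$ carry the round metric, i.e. the Riemannian metric induced by the Euclidean metric of $\mathbb{R}^{n+1}$. Let $N(x)$ be the number of eigenvalues $\le x$, counted with multiplicity, of the Laplace operator $-\operatorname{div}\operatorname{grad}$ acting on smooth functions on $\mathbb{S}^n$, where the multiplicity of an eigenvalue is the dimension of its eigenspace. Let $$w(x)=\frac{\omega_n}{(2\pi)^n}\,|\mathbb{S}^n|\,x^{n/2}$$ be the Weyl function of $\mathbb{S}^n$, where $\omega_n$ is the volume of the unit ball of $\mathbb{R}^n$ and $|\mathbb{S}^n|$ is the volume of $\mathbb{S}^n$. For each integer $k\ge 0$ put $v_k=k(k+n-1)$. Then for every integer $k\ge 0$ the number $N(v_k)$ is finite and $$w(v_k)<N(v_k),$$ and for every integer $k\ge 0$ with $k>\frac{n^2}{4}-n$, $$N(v_k)<w(v_{k+1}).$$ -/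

import Mathlib

open scoped Manifold ContDiff

noncomputable section

namespace RoundSphere

/-- The ambient Euclidean space `ℝ^{n+1}`. -/
abbrev Amb (n : ℕ) : Type := EuclideanSpace ℝ (Fin (n + 1))

/-- The round sphere `𝕊^n = {x ∈ ℝ^{n+1} | |x| = 1}`. -/
abbrev Sph (n : ℕ) : Type := Metric.sphere (0 : Amb n) 1

/-- The tangent space of `𝕊^n` at `x`, i.e. `x^⊥ ⊆ ℝ^{n+1}`. The inner product it inherits from
`ℝ^{n+1}` is the round metric. -/
abbrev Tan {n : ℕ} (x : Sph n) : Submodule ℝ (Amb n) := (Submodule.span ℝ {(x : Amb n)})ᗮ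

/-- A point of the sphere, used only as the value of `radial` at the origin. -/
def basePoint (n : ℕ) : Sph n := ⟨EuclideanSpace.single 0 1, by simp⟩

/-- The radial retraction `y ↦ y / |y|` of `ℝ^{n+1} ∖ {0}` onto `𝕊^n`. -/
def radial {n : ℕ} (y : Amb n) : Sph n :=
  if h : y = 0 then basePoint n
  else ⟨‖y‖⁻¹ • y, by simp [norm_smul, h]⟩

/-- The differential `d f_x : T_x 𝕊^n → F` of a map on the sphere: the restriction to `T_x 𝕊^n` of
the derivative at `x` of the extension `y ↦ f (y / |y|)` of `f` to `ℝ^{n+1} ∖ {0}`. -/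
def dSph {n : ℕ} {F : Type*} [NormedAddCommGroup F] [NormedSpace ℝ F]
    (f : Sph n → F) (x : Sph n) : Tan x →L[ℝ] F :=
  (fderiv ℝ (fun y => f (radial y)) (x : Amb n)).comp (Tan x).subtypeL

/-- The Riemannian gradient: `⟪grad f (x), v⟫ = d f_x (v)` for every `v ∈ T_x 𝕊^n`. -/
def grad {n : ℕ} (f : Sph n → ℝ) (x : Sph n) : Tan x :=
  (InnerProductSpace.toDual ℝ (Tan x)).symm (dSph f x)

/-- The Levi-Civita covariant derivative `v ↦ ∇_v X` at `x` of a vector field `X` tangent to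
`𝕊^n ⊆ ℝ^{n+1}`: the tangential component of the derivative of `X` as an `ℝ^{n+1}`-valued map. -/
def covDeriv {n : ℕ} (X : (x : Sph n) → Tan x) (x : Sph n) : Tan x →L[ℝ] Tan x :=
  (Tan x).orthogonalProjectionOnto.comp (dSph (fun z => (X z : Amb n)) x)

/-- The Riemannian divergence: the trace of `v ↦ ∇_v X`. -/
def divg {n : ℕ} (X : (x : Sph n) → Tan x) (x : Sph n) : ℝ :=
  LinearMap.trace ℝ (Tan x) (covDeriv X x : Tan x →ₗ[ℝ] Tan x)

/-- The Laplace operator `-div grad` of the round sphere. -/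
def laplace {n : ℕ} (f : Sph n → ℝ) (x : Sph n) : ℝ := -divg (grad f) x

theorem contDiffAt_comp_radial {n : ℕ} {f : Sph n → ℝ} (hf : ContMDiff (𝓡 n) 𝓘(ℝ) ∞ f)
    {x : Amb n} (hx : x ≠ 0) : ContDiffAt ℝ ∞ (fun y => f (radial y)) x := by
  have := Fact.mk (@finrank_euclideanSpace_fin ℝ _ (n + 1))
  let U : TopologicalSpace.Opens (Amb n) := ⟨{0}ᶜ, isOpen_compl_singleton⟩
  have h1 : ContMDiff 𝓘(ℝ, Amb n) 𝓘(ℝ, Amb n) ∞ (fun y : U => ‖(y : Amb n)‖⁻¹ • (y : Amb n)) := by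
    intro y
    have hy : (y : Amb n) ≠ 0 := y.2
    have : ContDiffAt ℝ ∞ (fun y : Amb n => ‖y‖⁻¹ • y) (y : Amb n) :=
      ((contDiffAt_norm ℝ hy).inv (norm_ne_zero_iff.2 hy)).smul contDiffAt_id
    exact (contMDiffAt_subtype_iff (f := fun y : Amb n => ‖y‖⁻¹ • y)).2 this.contMDiffAt
  have h2 : ∀ y : U, ‖(y : Amb n)‖⁻¹ • (y : Amb n) ∈ Metric.sphere (0 : Amb n) 1 := by
    intro y
    have hy : (y : Amb n) ≠ 0 := y.2
    simp [norm_smul, hy]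
  have h3 := hf.comp (h1.codRestrict_sphere h2)
  have h4 : ContMDiff 𝓘(ℝ, Amb n) 𝓘(ℝ) ∞ (fun y : U => f (radial (y : Amb n))) := by
    convert! h3 using 1
    funext y
    have hy : (y : Amb n) ≠ 0 := y.2
    simp [radial, hy, Set.codRestrict]
  exact ((contMDiffAt_subtype_iff (f := fun y : Amb n => f (radial y)) (x := ⟨x, hx⟩)).1
    (h4 ⟨x, hx⟩)).contDiffAt

theorem coe_ne_zero {n : ℕ} (x : Sph n) : (x : Amb n) ≠ 0 :=
  ne_zero_of_mem_unit_sphere x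

theorem coe_radial {n : ℕ} {y : Amb n} (hy : y ≠ 0) : (radial y : Amb n) = ‖y‖⁻¹ • y := by
  simp [radial, hy]

theorem radial_smul {n : ℕ} {y : Amb n} {t : ℝ} (ht : 0 < t) : radial (t • y) = radial y := by
  by_cases hy : y = 0
  · simp [hy]
  · apply Subtype.ext
    rw [coe_radial (smul_ne_zero ht.ne' hy), coe_radial hy, norm_smul, smul_smul,
      Real.norm_of_nonneg ht.le, mul_inv, mul_right_comm, inv_mul_cancel₀ ht.ne', one_mul]

theorem fderiv_comp_radial_self {n : ℕ} {f : Sph n → ℝ} (hf : ContMDiff (𝓡 n) 𝓘(ℝ) ∞ f)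
    (x : Sph n) : fderiv ℝ (fun y => f (radial y)) (x : Amb n) (x : Amb n) = 0 := by
  have h := ((contDiffAt_comp_radial hf (coe_ne_zero x)).differentiableAt (by simp)).hasFDerivAt
  have h1 : HasDerivAt (fun t : ℝ => t • (x : Amb n)) (x : Amb n) 1 := by
    simpa using (hasDerivAt_id (1 : ℝ)).smul_const (x : Amb n)
  have h2 := HasFDerivAt.comp_hasDerivAt (1 : ℝ) (by simpa using h) h1
  have h3 : (fun t : ℝ => f (radial (t • (x : Amb n)))) =ᶠ[nhds 1]
      fun _ => f (radial (x : Amb n)) := by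
    filter_upwards [lt_mem_nhds one_pos] with t ht
    rw [radial_smul ht]
  exact h2.unique ((hasDerivAt_const (1 : ℝ) _).congr_of_eventuallyEq h3)

theorem coe_grad {n : ℕ} {f : Sph n → ℝ} (hf : ContMDiff (𝓡 n) 𝓘(ℝ) ∞ f) (x : Sph n) :
    (grad f x : Amb n) =
      (InnerProductSpace.toDual ℝ (Amb n)).symm (fderiv ℝ (fun y => f (radial y)) (x : Amb n)) := by
  refine ext_inner_right ℝ fun u => ?_
  rw [InnerProductSpace.toDual_symm_apply]
  obtain ⟨a, ha, b, hb, rfl⟩ :=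
    (Submodule.span ℝ {(x : Amb n)}).exists_add_mem_mem_orthogonal u
  obtain ⟨c, rfl⟩ := Submodule.mem_span_singleton.1 ha
  have h1 : inner ℝ (grad f x : Amb n) (c • (x : Amb n)) = 0 :=
    Submodule.inner_left_of_mem_orthogonal ha (grad f x).2
  have h2 : inner ℝ (grad f x : Amb n) b = fderiv ℝ (fun y => f (radial y)) (x : Amb n) b :=
    InnerProductSpace.toDual_symm_apply (𝕜 := ℝ) (x := (⟨b, hb⟩ : Tan x)) (y := dSph f x)
  rw [inner_add_right, h1, h2, map_add, map_smul, fderiv_comp_radial_self hf]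
  simp

theorem differentiableAt_grad {n : ℕ} {f : Sph n → ℝ} (hf : ContMDiff (𝓡 n) 𝓘(ℝ) ∞ f)
    (x : Sph n) :
    DifferentiableAt ℝ (fun y => (grad f (radial y) : Amb n)) (x : Amb n) := by
  simp only [coe_grad hf]
  have hx := coe_ne_zero x
  have h1 : DifferentiableAt ℝ (fun y : Amb n => (radial y : Amb n)) (x : Amb n) := by
    have : DifferentiableAt ℝ (fun y : Amb n => ‖y‖⁻¹ • y) (x : Amb n) :=
      ((((contDiffAt_norm ℝ hx).inv (norm_ne_zero_iff.2 hx)).smul contDiffAt_id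
        : ContDiffAt ℝ ∞ (fun y : Amb n => ‖y‖⁻¹ • y) (x : Amb n))).differentiableAt (by simp)
    refine this.congr_of_eventuallyEq ?_
    filter_upwards [isOpen_compl_singleton.mem_nhds hx] with y hy
    exact coe_radial hy
  have h2 : DifferentiableAt ℝ (fderiv ℝ (fun y => f (radial y))) (radial (x : Amb n) : Amb n) :=
    ((contDiffAt_comp_radial hf (coe_ne_zero _)).fderiv_right (m := 1)
      (by norm_cast)).differentiableAt (by simp)
  have h3 := DifferentiableAt.comp (x : Amb n) h2 h1
  exact (InnerProductSpace.toDual ℝ (Amb n)).symm.toContinuousLinearEquiv.differentiableAt.comp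
    (x : Amb n) h3

theorem laplace_add {n : ℕ} {f g : Sph n → ℝ} (hf : ContMDiff (𝓡 n) 𝓘(ℝ) ∞ f)
    (hg : ContMDiff (𝓡 n) 𝓘(ℝ) ∞ g) (x : Sph n) :
    laplace (f + g) x = laplace f x + laplace g x := by
  have h1 : ∀ z, grad (f + g) z = grad f z + grad g z := by
    intro z
    have hf' := (contDiffAt_comp_radial hf (coe_ne_zero z)).differentiableAt (by simp)
    have hg' := (contDiffAt_comp_radial hg (coe_ne_zero z)).differentiableAt (by simp)
    simp only [grad, ← map_add]
    congr 1
    ext v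
    simp [dSph, fderiv_fun_add hf' hg']
  have h2 : covDeriv (grad (f + g)) x = covDeriv (grad f) x + covDeriv (grad g) x := by
    ext v
    simp [covDeriv, dSph, h1, fderiv_fun_add (differentiableAt_grad hf x)
      (differentiableAt_grad hg x)]
  simp [laplace, divg, h2]
  ring

theorem laplace_smul {n : ℕ} {f : Sph n → ℝ} (hf : ContMDiff (𝓡 n) 𝓘(ℝ) ∞ f) (c : ℝ)
    (x : Sph n) : laplace (c • f) x = c * laplace f x := by
  have h1 : ∀ z, grad (c • f) z = c • grad f z := by
    intro z
    have hf' := (contDiffAt_comp_radial hf (coe_ne_zero z)).differentiableAt (by simp)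
    have h : dSph (c • f) z = c • dSph f z := by
      ext v
      simp [dSph, fderiv_const_mul hf']
    simp [grad, h]
  have h2 : covDeriv (grad (c • f)) x = c • covDeriv (grad f) x := by
    ext v
    simp [covDeriv, dSph, h1, fderiv_fun_const_smul (differentiableAt_grad hf x)]
  simp [laplace, divg, h2]

/-- The eigenspace of `-div grad` on `C^∞(𝕊^n)` for the real number `μ`. -/
def eigenspace (n : ℕ) (μ : ℝ) : Submodule ℝ (Sph n → ℝ) where
  carrier := {f | ContMDiff (𝓡 n) 𝓘(ℝ) ∞ f ∧ ∀ x, laplace f x = μ * f x}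
  add_mem' := by
    rintro f g ⟨hf, hf'⟩ ⟨hg, hg'⟩
    refine ⟨hf.add hg, fun x => ?_⟩
    rw [laplace_add hf hg, hf', hg', Pi.add_apply, mul_add]
  zero_mem' := by
    refine ⟨contMDiff_const, fun x => ?_⟩
    have := laplace_smul (n := n) (f := fun _ => 0) contMDiff_const 0 x
    rw [zero_smul, zero_mul] at this
    rw [this]
    simp
  smul_mem' := by
    rintro c f ⟨hf, hf'⟩
    refine ⟨(contMDiff_const (c := c)).mul hf, fun x => ?_⟩
    rw [laplace_smul hf, hf', Pi.smul_apply, smul_eq_mul]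
    ring

/-- The multiplicity of `μ` as an eigenvalue of `𝕊^n` (`0` if `μ` is not an eigenvalue). -/
def mult (n : ℕ) (μ : ℝ) : ℕ∞ := Cardinal.toENat (Module.rank ℝ (eigenspace n μ))

/-- The eigenvalue counting function `N(x)` of `𝕊^n`: the number of eigenvalues `≤ x`, counted with
multiplicity. -/
def counting (n : ℕ) (x : ℝ) : ℕ∞ := ∑' μ : Set.Iic x, mult n μ

/-- The volume `ω_n` of the unit ball of `ℝ^n`. -/
def ballVolume (n : ℕ) : ℝ :=
  (MeasureTheory.volume (Metric.ball (0 : EuclideanSpace ℝ (Fin n)) 1)).toReal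

/-- The volume `|𝕊^n|`, for the surface measure that Lebesgue measure induces on the unit sphere. -/
def sphereVolume (n : ℕ) : ℝ :=
  ((MeasureTheory.volume : MeasureTheory.Measure (Amb n)).toSphere Set.univ).toReal

/-- The Weyl function `w(x) = ω_n (2π)^{-n} |𝕊^n| x^{n/2}` of `𝕊^n`. -/
def weyl (n : ℕ) (x : ℝ) : ℝ :=
  ballVolume n / (2 * Real.pi) ^ n * sphereVolume n * x ^ ((n : ℝ) / 2)

/-- `v_k = k (k + n - 1)`. -/
def v (n k : ℕ) : ℝ := (k : ℝ) * ((k : ℝ) + (n : ℝ) - 1)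

end RoundSphere

end

/-!
If `P` is a homogeneous polynomial of degree `d` on `ℝ^{n+1}`, then on the sphere
`-div grad (P|_{𝕊^n}) = v_d P - Δ P`, with `Δ` the Laplacian of `ℝ^{n+1}`. So the Laplace operator
is upper triangular with diagonal `v_0, v_1, …` along the filtration of the polynomial functions by
degree. The operator is symmetric in `L²` and polynomials are dense, hence its eigenvalues are
exactly the `v_k`, and `N(v_k)` is the dimension of the space of polynomial functions of degree at
most `k`. Since `|x|² = 1` on the sphere, that space is the direct sum of the restrictions of the
homogeneous polynomials of degrees `k` and `k - 1`, so
`n! N(v_k) = 2 (k + n/2) (k + 1) (k + 2) ⋯ (k + n - 1)`.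

On the other side `n! w(x) = 2 x^{n/2}`. Pairing the factor `k + i` with `k + n - i` puts the
product `(k + 1) ⋯ (k + n - 1)` between `v_k^{(n-1)/2}` and `(k + n/2)^{n-1}`, and
`v_k < (k + n/2)² = v_{k+1} - (k - n²/4 + n)`.
-/

noncomputable section

namespace RoundSphere

open scoped Laplacian Gradient RealInnerProductSpace
open MeasureTheory Module MvPolynomial

/-! ### Operators that are triangular along a filtration -/

/-- A filtration `F 0 ≤ F 1 ≤ ⋯` starting at `0`, with respect to which `T` is upper triangular
with diagonal `c`: on `F (k + 1) / F k` the operator `T` acts as multiplication by `c k`. -/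
structure IsTriangularFiltration {K M : Type*} [Field K] [AddCommGroup M] [Module K M]
    (T : End K M) (F : ℕ → Submodule K M) (c : ℕ → K) : Prop where
  zero : F 0 = ⊥
  mono : Monotone F
  sub_smul_mem : ∀ k, ∀ x ∈ F (k + 1), T x - c k • x ∈ F k

namespace IsTriangularFiltration

section Field

variable {K M : Type*} [Field K] [AddCommGroup M] [Module K M] {T : End K M}
  {F : ℕ → Submodule K M} {c : ℕ → K} {μ : K} {k : ℕ}

theorem apply_mem (hF : IsTriangularFiltration T F c) {x : M} (hx : x ∈ F k) : T x ∈ F k := by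
  have hx' : x ∈ F (k + 1) := hF.mono k.le_succ hx
  simpa using (F k).add_mem (hF.sub_smul_mem k x hx') ((F k).smul_mem (c k) hx)

theorem disjoint_eigenspace (hF : IsTriangularFiltration T F c) (hμ : ∀ j < k, c j ≠ μ) :
    Disjoint (F k) (End.eigenspace T μ) := by
  rw [Submodule.disjoint_def]
  intro x hx hTx
  rw [End.mem_eigenspace_iff] at hTx
  induction k with
  | zero => simpa [hF.zero] using hx
  | succ k ih =>
    have hsmul : (μ - c k) • x ∈ F k := by
      simpa only [hTx, sub_smul] using hF.sub_smul_mem k x hx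
    have hne : μ - c k ≠ 0 := sub_ne_zero.2 (hμ k k.lt_succ_self).symm
    exact ih (fun j hj => hμ j (hj.trans k.lt_succ_self)) (((F k).smul_mem_iff hne).1 hsmul)

theorem finrank_succ (hF : IsTriangularFiltration T F c) [∀ k, FiniteDimensional K (F k)]
    (hc : Function.Injective c) (hle : End.eigenspace T (c k) ≤ F (k + 1)) :
    finrank K (F (k + 1)) = finrank K (F k) + finrank K (End.eigenspace T (c k)) := by
  let S : M →ₗ[K] M := T - c k • 1
  let A : F (k + 1) →ₗ[K] F k := S.restrict (hF.sub_smul_mem k)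
  have hinj : Function.Injective (A ∘ₗ Submodule.inclusion (hF.mono k.le_succ)) := by
    rw [← LinearMap.ker_eq_bot, LinearMap.ker_eq_bot']
    intro x hx
    have hTx : T x = c k • (x : M) := sub_eq_zero.1 (congrArg Subtype.val hx)
    exact Subtype.ext <| Submodule.disjoint_def.1
      (hF.disjoint_eigenspace fun j hj => hc.ne hj.ne) x x.2 (End.mem_eigenspace_iff.2 hTx)
  have hsurj : Function.Surjective A :=
    .of_comp (LinearMap.injective_iff_surjective.1 hinj)
  have hker : finrank K A.ker = finrank K (End.eigenspace T (c k)) := by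
    have : A.ker = (End.eigenspace T (c k)).comap (F (k + 1)).subtype := by
      ext x
      rw [LinearMap.mem_ker, Submodule.mem_comap, End.mem_eigenspace_iff, ← sub_eq_zero (a := T _)]
      exact Subtype.ext_iff
    rw [this]
    exact (Submodule.comapSubtypeEquivOfLe hle).finrank_eq
  rw [← A.finrank_range_add_finrank_ker, LinearMap.range_eq_top.2 hsurj, finrank_top, hker]

end Field

section InnerProductSpace

variable {𝕜 E : Type*} [RCLike 𝕜] [NormedAddCommGroup E] [InnerProductSpace 𝕜 E]
  {T : E →ₗ[𝕜] E} {F : ℕ → Submodule 𝕜 E} {c : ℕ → 𝕜} {μ : 𝕜} {k : ℕ}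

theorem mem_orthogonal_succ (hF : IsTriangularFiltration T F c) (hT : T.IsSymmetric) {z : E}
    (hz : z ∈ End.eigenspace T μ) (hμ : c k ≠ μ) (hzk : z ∈ (F k)ᗮ) : z ∈ (F (k + 1))ᗮ := by
  obtain rfl | hz0 := eq_or_ne z 0
  · exact Submodule.zero_mem _
  have hreal : (starRingEnd 𝕜) μ = μ :=
    hT.conj_eigenvalue_eq_self (End.hasEigenvalue_of_hasEigenvector ⟨hz, hz0⟩)
  refine (Submodule.mem_orthogonal' _ _).2 fun x hx => ?_
  have hinner : (μ - c k) * inner 𝕜 z x = 0 := by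
    rw [← Submodule.inner_left_of_mem_orthogonal (hF.sub_smul_mem k x hx) hzk, inner_sub_right,
      ← hT z x, End.mem_eigenspace_iff.1 hz, inner_smul_left, inner_smul_right, hreal, sub_mul]
  exact (mul_eq_zero.1 hinner).resolve_left (sub_ne_zero.2 hμ.symm)

theorem eq_zero_of_mem_orthogonal (hF : IsTriangularFiltration T F c) (hT : T.IsSymmetric)
    (hdense : (⨆ j, F j)ᗮ = ⊥) {z : E} (hz : z ∈ End.eigenspace T μ) (hμ : ∀ j ≥ k, c j ≠ μ)
    (hzk : z ∈ (F k)ᗮ) : z = 0 := by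
  have hge : ∀ j ≥ k, z ∈ (F j)ᗮ := fun j hj => by
    induction j, hj using Nat.le_induction with
    | base => exact hzk
    | succ j hj ih => exact hF.mem_orthogonal_succ hT hz (hμ j hj) ih
  have hall : z ∈ ⨅ j, (F j)ᗮ := (Submodule.mem_iInf _).2 fun j =>
    Submodule.orthogonal_le (hF.mono (le_max_left j k)) (hge _ (le_max_right j k))
  rwa [Submodule.iInf_orthogonal, hdense, Submodule.mem_bot] at hall

theorem eigenspace_eq_bot (hF : IsTriangularFiltration T F c) (hT : T.IsSymmetric)
    (hdense : (⨆ j, F j)ᗮ = ⊥) (hμ : ∀ j, c j ≠ μ) : End.eigenspace T μ = ⊥ :=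
  (Submodule.eq_bot_iff _).2 fun _ hz =>
    hF.eq_zero_of_mem_orthogonal (k := 0) hT hdense hz (fun j _ => hμ j) (by simp [hF.zero])

theorem eigenspace_le (hF : IsTriangularFiltration T F c) (hT : T.IsSymmetric)
    (hdense : (⨆ j, F j)ᗮ = ⊥) (hμ : ∀ j ≥ k, c j ≠ μ) [(F k).HasOrthogonalProjection] :
    End.eigenspace T μ ≤ F k := by
  intro z hz
  set p : E := (F k).starProjection z with hp
  have hpF : p ∈ F k := (F k).starProjection_apply_mem z
  have hzp : z - p ∈ (F k)ᗮ := (F k).sub_starProjection_mem_orthogonal z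
  rw [End.mem_eigenspace_iff] at hz
  -- By symmetry `T` preserves `(F k)ᗮ` too, so it commutes with the projection onto `F k`.
  have hTzp : T (z - p) ∈ (F k)ᗮ := (Submodule.mem_orthogonal' _ _).2 fun x hx => by
    rw [hT]
    exact Submodule.inner_left_of_mem_orthogonal (hF.apply_mem hx) hzp
  have hTp : T p - μ • p = 0 := by
    refine Submodule.disjoint_def.1 (F k).orthogonal_disjoint _
      ((F k).sub_mem (hF.apply_mem hpF) ((F k).smul_mem μ hpF)) ?_
    have hdiff : T p - μ • p = μ • (z - p) - T (z - p) := by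
      rw [map_sub, hz]
      module
    rw [hdiff]
    exact (F k)ᗮ.sub_mem ((F k)ᗮ.smul_mem μ hzp) hTzp
  have hTsub : z - p ∈ End.eigenspace T μ :=
    Submodule.sub_mem _ (End.mem_eigenspace_iff.2 hz) (End.mem_eigenspace_iff.2 (sub_eq_zero.1 hTp))
  have hzp0 : z - p = 0 := hF.eq_zero_of_mem_orthogonal hT hdense hTsub hμ hzp
  rwa [sub_eq_zero.1 hzp0]

theorem finrank_eq_sum (hF : IsTriangularFiltration T F c) (hT : T.IsSymmetric)
    (hdense : (⨆ j, F j)ᗮ = ⊥) (hc : Function.Injective c) [∀ k, FiniteDimensional 𝕜 (F k)]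
    (k : ℕ) :
    finrank 𝕜 (F k) = ∑ j ∈ Finset.range k, finrank 𝕜 (End.eigenspace T (c j)) := by
  induction k with
  | zero => simp [hF.zero]
  | succ k ih =>
    have hle : End.eigenspace T (c k) ≤ F (k + 1) :=
      hF.eigenspace_le hT hdense fun j hj => hc.ne (Nat.lt_of_succ_le hj).ne'
    rw [Finset.sum_range_succ, hF.finrank_succ hc hle, ih]

end InnerProductSpace

end IsTriangularFiltration

/-! ### The Laplacian of Euclidean space -/

theorem hasFDerivAt_fderiv {E F : Type*} [NormedAddCommGroup E] [NormedSpace ℝ E]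
    [NormedAddCommGroup F] [NormedSpace ℝ F] {f : E → F} {x : E} (hf : ContDiffAt ℝ 2 f x) :
    HasFDerivAt (fderiv ℝ f) (fderiv ℝ (fderiv ℝ f) x) x :=
  ((hf.fderiv_right (m := 1) (by norm_num)).differentiableAt (by simp)).hasFDerivAt

section EuclideanLaplacian

variable {E : Type*} [NormedAddCommGroup E] [InnerProductSpace ℝ E] {F G : E → ℝ} {x : E}

section Gradient

variable [CompleteSpace E]

theorem hasFDerivAt_gradient (hF : ContDiffAt ℝ 2 F x) :
    HasFDerivAt (∇ F)
      ((InnerProductSpace.toDual ℝ E).symm.toContinuousLinearEquiv.toContinuousLinearMap ∘L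
        fderiv ℝ (fderiv ℝ F) x) x :=
  (InnerProductSpace.toDual ℝ E).symm.toContinuousLinearEquiv.hasFDerivAt.comp x
    (hasFDerivAt_fderiv hF)

theorem inner_fderiv_gradient_left (hF : ContDiffAt ℝ 2 F x) (u w : E) :
    ⟪fderiv ℝ (∇ F) x u, w⟫ = fderiv ℝ (fderiv ℝ F) x u w := by
  rw [(hasFDerivAt_gradient hF).fderiv]
  exact InnerProductSpace.toDual_symm_apply

end Gradient

variable [FiniteDimensional ℝ E]

theorem laplacian_eq_sum_fderiv_fderiv {ι : Type*} [Fintype ι] (b : OrthonormalBasis ι ℝ E)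
    (F : E → ℝ) (x : E) : Δ F x = ∑ i, fderiv ℝ (fderiv ℝ F) x (b i) (b i) := by
  simp [InnerProductSpace.laplacian_eq_iteratedFDeriv_orthonormalBasis F b,
    iteratedFDeriv_two_apply]

theorem contDiffAt_laplacian (hF : ContDiffAt ℝ ∞ F x) : ContDiffAt ℝ ∞ (Δ F) x := by
  rw [funext (laplacian_eq_sum_fderiv_fderiv (stdOrthonormalBasis ℝ E) F)]
  exact ContDiffAt.sum fun i _ =>
    (((hF.fderiv_right (m := ∞) (by simp)).fderiv_right (m := ∞) (by simp)).clm_apply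
      contDiffAt_const).clm_apply contDiffAt_const

theorem trace_fderiv_gradient (hF : ContDiffAt ℝ 2 F x) :
    LinearMap.trace ℝ E (fderiv ℝ (∇ F) x : E →ₗ[ℝ] E) = Δ F x := by
  rw [LinearMap.trace_eq_sum_inner _ (stdOrthonormalBasis ℝ E),
    laplacian_eq_sum_fderiv_fderiv (stdOrthonormalBasis ℝ E)]
  refine Finset.sum_congr rfl fun i _ => ?_
  rw [real_inner_comm, ContinuousLinearMap.coe_coe, inner_fderiv_gradient_left hF]

theorem laplacian_mul (hF : ContDiffAt ℝ 2 F x) (hG : ContDiffAt ℝ 2 G x) :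
    Δ (F * G) x = F x * Δ G x + G x * Δ F x + 2 * ⟪∇ F x, ∇ G x⟫ := by
  have hfderiv : fderiv ℝ (F * G) =ᶠ[nhds x] F • fderiv ℝ G + G • fderiv ℝ F := by
    filter_upwards [hF.eventually (by simp), hG.eventually (by simp)] with y hFy hGy
    exact fderiv_mul (hFy.differentiableAt (by simp)) (hGy.differentiableAt (by simp))
  have hfderiv₂ := (((hF.differentiableAt (by simp)).hasFDerivAt.smul (hasFDerivAt_fderiv hG)).add
    ((hG.differentiableAt (by simp)).hasFDerivAt.smul
      (hasFDerivAt_fderiv hF))).congr_of_eventuallyEq hfderiv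
  let b := stdOrthonormalBasis ℝ E
  have hinner : ⟪∇ F x, ∇ G x⟫ = ∑ i, fderiv ℝ F x (b i) * fderiv ℝ G x (b i) := by
    rw [← b.sum_inner_mul_inner]
    refine Finset.sum_congr rfl fun i _ => ?_
    rw [inner_gradient_left, real_inner_comm, inner_gradient_left]
  simp only [laplacian_eq_sum_fderiv_fderiv b, hfderiv₂.fderiv, hinner, Finset.mul_sum,
    ← Finset.sum_add_distrib]
  refine Finset.sum_congr rfl fun i _ => ?_
  simp only [add_apply, smul_apply, ContinuousLinearMap.smulRight_apply, smul_eq_mul]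
  ring

theorem laplacian_comp_smul (F : E → ℝ) (t : ℝ) (x : E) :
    Δ (fun y => F (t • y)) x = t ^ 2 * Δ F (t • x) := by
  have hfderiv : fderiv ℝ (fun y => F (t • y)) = t • fun y => fderiv ℝ F (t • y) :=
    funext fun _ => fderiv_comp_smul t
  have hfderiv₂ : fderiv ℝ (fderiv ℝ fun y => F (t • y)) x =
      t ^ 2 • fderiv ℝ (fderiv ℝ F) (t • x) := by
    rw [hfderiv, congrFun (fderiv_const_smul_field (f := fun y => fderiv ℝ F (t • y)) t) x,
      Pi.smul_apply, fderiv_comp_smul t, smul_smul, sq]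
  simp [laplacian_eq_sum_fderiv_fderiv (stdOrthonormalBasis ℝ E), hfderiv₂, Finset.mul_sum]

end EuclideanLaplacian

section EulerIdentity

variable {E : Type*} [NormedAddCommGroup E] [NormedSpace ℝ E] {F : E → ℝ} {d : ℕ} {x : E}

theorem fderiv_apply_self_of_homogeneous (hF : DifferentiableAt ℝ F x)
    (hhom : ∀ t : ℝ, 0 < t → F (t • x) = t ^ d * F x) : fderiv ℝ F x x = d * F x := by
  have hline : HasDerivAt (fun t : ℝ => t • x) x 1 := by
    simpa using (hasDerivAt_id (1 : ℝ)).smul_const x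
  have hcomp : HasDerivAt (fun t : ℝ => F (t • x)) (fderiv ℝ F x x) 1 :=
    HasFDerivAt.comp_hasDerivAt 1 (by simpa using hF.hasFDerivAt) hline
  have hpow : HasDerivAt (fun t : ℝ => t ^ d * F x) (d * F x) 1 := by
    simpa using (hasDerivAt_pow d (1 : ℝ)).mul_const (F x)
  refine hcomp.unique (hpow.congr_of_eventuallyEq ?_)
  filter_upwards [lt_mem_nhds one_pos] with t ht using hhom t ht

theorem fderiv_fderiv_apply_self_of_homogeneous (hF : ContDiffAt ℝ 2 F x)
    (hhom : ∀ y, ∀ t : ℝ, 0 < t → F (t • y) = t ^ d * F y) :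
    fderiv ℝ (fderiv ℝ F) x x x = d * (d - 1) * F x := by
  have hdiff : DifferentiableAt ℝ F x := hF.differentiableAt (by simp)
  have hEuler : (fun y => fderiv ℝ F y y) =ᶠ[nhds x] fun y => d * F y := by
    filter_upwards [hF.eventually (by simp)] with y hy
    exact fderiv_apply_self_of_homogeneous (hy.differentiableAt (by simp)) (hhom y)
  have hderiv := ((hasFDerivAt_fderiv hF).clm_apply (hasFDerivAt_id (𝕜 := ℝ) x)).unique
    ((hdiff.hasFDerivAt.const_mul (d : ℝ)).congr_of_eventuallyEq hEuler)
  have happly := DFunLike.congr_fun hderiv x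
  simp only [id_eq, fderiv_apply_self_of_homogeneous hdiff (hhom x), add_apply,
    ContinuousLinearMap.comp_apply, ContinuousLinearMap.coe_id', ContinuousLinearMap.flip_apply,
    smul_apply, smul_eq_mul] at happly
  linear_combination happly

end EulerIdentity

section IntegrationByParts

variable {E : Type*} [NormedAddCommGroup E] [InnerProductSpace ℝ E] [FiniteDimensional ℝ E]
  [MeasurableSpace E] [BorelSpace E] {U V : E → ℝ}

theorem integrable_mul_laplacian {μ : Measure E} [IsFiniteMeasureOnCompacts μ]
    (hU : Continuous U) (hUsupp : HasCompactSupport U) (hV : ContDiff ℝ ∞ V) :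
    Integrable (fun y => U y * Δ V y) μ :=
  (hU.mul (contDiff_iff_contDiffAt.2 fun _ =>
    contDiffAt_laplacian hV.contDiffAt).continuous).integrable_of_hasCompactSupport hUsupp.mul_right

theorem integral_mul_laplacian_sub_mul_laplacian {μ : Measure E} [μ.IsAddHaarMeasure]
    (hU : ContDiff ℝ ∞ U) (hUsupp : HasCompactSupport U)
    (hV : ContDiff ℝ ∞ V) (hVsupp : HasCompactSupport V) :
    ∫ y, (U y * Δ V y - V y * Δ U y) ∂μ = 0 := by
  have hparts := SchwartzMap.integral_mul_laplacian_right_eq_left (μ := μ)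
    (hUsupp.toSchwartzMap hU) (hVsupp.toSchwartzMap hV)
  simp only [SchwartzMap.laplacian_apply] at hparts
  rw [integral_sub (integrable_mul_laplacian hU.continuous hUsupp hV)
    (integrable_mul_laplacian hV.continuous hVsupp hU), sub_eq_zero]
  exact hparts.trans (integral_congr_ae (.of_forall fun y => mul_comm _ _))

end IntegrationByParts

/-! ### Polynomials -/

section PolynomialFunctions

variable {ι R : Type*} [CommSemiring R]

theorem eval_smul_of_isHomogeneous {P : MvPolynomial ι R} {d : ℕ} (hP : P.IsHomogeneous d) (t : R)
    (y : ι → R) : eval (t • y) P = t ^ d * eval y P := by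
  rw [eval_eq, eval_eq, Finset.mul_sum]
  refine Finset.sum_congr rfl fun α hα => ?_
  have hdegree : ∑ i ∈ α.support, α i = d := (hP.degree_eq_sum_deg_support hα).symm
  simp only [Pi.smul_apply, smul_eq_mul, mul_pow, Finset.prod_mul_distrib,
    Finset.prod_pow_eq_pow_sum, hdegree]
  ring

theorem pderiv_eq_zero_of_isHomogeneous_zero {P : MvPolynomial ι R} (hP : P.IsHomogeneous 0)
    (i : ι) : pderiv i P = 0 := by
  rw [totalDegree_eq_zero_iff_eq_C.1 ((totalDegree_zero_iff_isHomogeneous ι).2 hP), pderiv_C]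

variable [Fintype ι]

/-- The Laplacian `∑ i, ∂ᵢ²` of a polynomial. -/
def polyLaplacian (P : MvPolynomial ι R) : MvPolynomial ι R := ∑ i, pderiv i (pderiv i P)

theorem isHomogeneous_polyLaplacian {P : MvPolynomial ι R} {d : ℕ} (hP : P.IsHomogeneous d) :
    (polyLaplacian P).IsHomogeneous (d - 2) :=
  IsHomogeneous.sum _ _ _ fun _ _ => hP.pderiv.pderiv

theorem polyLaplacian_eq_zero {P : MvPolynomial ι R} {d : ℕ} (hP : P.IsHomogeneous d)
    (hd : d < 2) : polyLaplacian P = 0 := by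
  refine Finset.sum_eq_zero fun i _ => pderiv_eq_zero_of_isHomogeneous_zero ?_ i
  convert hP.pderiv using 1
  lia

variable (P : MvPolynomial ι ℝ)

theorem contDiff_eval : ContDiff ℝ ∞ (fun y : EuclideanSpace ℝ ι => eval y.ofLp P) := by
  induction P using MvPolynomial.induction_on with
  | C a => simpa using contDiff_const
  | add P Q hP hQ => simpa using hP.add hQ
  | mul_X P i hP => simpa using hP.mul (EuclideanSpace.proj (𝕜 := ℝ) i).contDiff

omit [Fintype ι] in
theorem fderiv_eval_single [Finite ι] [DecidableEq ι] (y : EuclideanSpace ℝ ι) (i : ι) :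
    fderiv ℝ (fun y : EuclideanSpace ℝ ι => eval y.ofLp P) y (EuclideanSpace.single i 1) =
      eval y.ofLp (pderiv i P) := by
  have := Fintype.ofFinite ι
  have hdiff (P : MvPolynomial ι ℝ) :
      DifferentiableAt ℝ (fun y : EuclideanSpace ℝ ι => eval y.ofLp P) y :=
    (contDiff_eval P).differentiable (by simp) y
  induction P using MvPolynomial.induction_on with
  | C a => simp
  | add P Q hP hQ => simp [fderiv_fun_add (hdiff P) (hdiff Q), hP, hQ]
  | mul_X P j hP =>
    have hproj : HasFDerivAt (fun y : EuclideanSpace ℝ ι => y.ofLp j)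
        (EuclideanSpace.proj j : EuclideanSpace ℝ ι →L[ℝ] ℝ) y :=
      (EuclideanSpace.proj (𝕜 := ℝ) j).hasFDerivAt
    simp only [map_mul, eval_X]
    rw [((hdiff P).hasFDerivAt.fun_mul hproj).fderiv]
    rcases eq_or_ne i j with rfl | hij
    · simp [hP]
    · simp [hP, pderiv_X, hij.symm, mul_comm]

theorem laplacian_eval (y : EuclideanSpace ℝ ι) :
    Δ (fun y : EuclideanSpace ℝ ι => eval y.ofLp P) y = eval y.ofLp (polyLaplacian P) := by
  classical
  rw [laplacian_eq_sum_fderiv_fderiv (EuclideanSpace.basisFun ι ℝ), polyLaplacian, map_sum]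
  refine Finset.sum_congr rfl fun i _ => ?_
  have hfderiv := hasFDerivAt_fderiv ((contDiff_eval P).contDiffAt (x := y).of_le (by norm_cast))
  have happly := (hfderiv.clm_apply (hasFDerivAt_const (EuclideanSpace.single i (1 : ℝ)) y)).fderiv
  simp only [fderiv_eval_single] at happly
  have := DFunLike.congr_fun happly (EuclideanSpace.single i 1)
  simpa [fderiv_eval_single] using this.symm

end PolynomialFunctions

section HomogeneousPolynomials

variable {ι : Type*} [Fintype ι]

theorem finrank_homogeneousSubmodule (R : Type*) [CommRing R] [Nontrivial R] (d : ℕ) :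
    finrank R (homogeneousSubmodule ι R d) = (Fintype.card ι).multichoose d := by
  classical
  have hmonomials : {α : ι →₀ ℕ | α.degree = d} =
      (Finset.univ.finsuppAntidiag d : Finset (ι →₀ ℕ)) := by
    ext α
    simp [Finsupp.degree_eq_sum]
  rw [homogeneousSubmodule_eq_finsupp_supported, hmonomials,
    (AddMonoidAlgebra.supportedEquivFinsupp _).finrank_eq, finrank_finsupp_self,
    ← Nat.card_eq_fintype_card, Nat.card_coe_set_eq, Set.ncard_coe_finset,
    Finset.card_finsuppAntidiag_nat_eq_multichoose, Finset.card_univ]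

theorem isHomogeneous_sum_X_sq (R : Type*) [CommSemiring R] :
    (∑ i : ι, X i ^ 2 : MvPolynomial ι R).IsHomogeneous 2 :=
  IsHomogeneous.sum _ _ _ fun i _ => isHomogeneous_X_pow i 2

end HomogeneousPolynomials

/-! ### The Laplace operator of the sphere -/

variable {n : ℕ}

theorem radial_coe (x : Sph n) : radial (x : Amb n) = x :=
  Subtype.ext (by simp [coe_radial (coe_ne_zero x)])

theorem norm_smul_radial (y : Amb n) : ‖y‖ • (radial y : Amb n) = y := by
  rcases eq_or_ne y 0 with rfl | hy
  · simp
  · rw [coe_radial hy, smul_inv_smul₀ (norm_ne_zero_iff.2 hy)]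

theorem hasFDerivAt_radial (x : Sph n) :
    HasFDerivAt (fun y : Amb n => (radial y : Amb n))
      (ContinuousLinearMap.id ℝ (Amb n) - (innerSL ℝ (x : Amb n)).smulRight (x : Amb n))
      (x : Amb n) := by
  have hx : ‖(x : Amb n)‖ = 1 := norm_eq_of_mem_sphere x
  have hnorm : HasFDerivAt (fun y : Amb n => √(‖y‖ ^ 2)) _ (x : Amb n) :=
    (hasStrictFDerivAt_norm_sq (x : Amb n)).hasFDerivAt.sqrt (by simp [hx])
  have hinv := (hasDerivAt_inv (x := √(‖(x : Amb n)‖ ^ 2)) (by simp [hx])).comp_hasFDerivAt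
    (x : Amb n) hnorm
  refine ((hinv.smul (hasFDerivAt_id (x : Amb n))).congr_fderiv ?_).congr_of_eventuallyEq ?_
  · ext1 w
    simp [hx, sub_eq_add_neg]
  · filter_upwards [isOpen_compl_singleton.mem_nhds (coe_ne_zero x)] with y hy
    simp [coe_radial hy]

theorem inner_coe_tan (x : Sph n) (w : Tan x) : ⟪(x : Amb n), (w : Amb n)⟫ = 0 :=
  Submodule.mem_orthogonal_singleton_iff_inner_right.1 w.2

section FrechetDerivative

variable {H : Type*} [NormedAddCommGroup H] [NormedSpace ℝ H] {G : Amb n → H} {x : Sph n}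

theorem fderiv_comp_coe_radial (hG : DifferentiableAt ℝ G x) :
    fderiv ℝ (fun y => G (radial y)) (x : Amb n) =
      fderiv ℝ G x ∘L
        (ContinuousLinearMap.id ℝ (Amb n) - (innerSL ℝ (x : Amb n)).smulRight (x : Amb n)) := by
  have hG' : HasFDerivAt G (fderiv ℝ G x) (radial (x : Amb n) : Amb n) := by
    rw [radial_coe]
    exact hG.hasFDerivAt
  exact (hG'.comp (x : Amb n) (hasFDerivAt_radial x)).fderiv

theorem dSph_comp_coe_apply (hG : DifferentiableAt ℝ G x) (w : Tan x) :
    dSph (fun z : Sph n => G z) x w = fderiv ℝ G x w := by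
  simp [dSph, fderiv_comp_coe_radial hG, inner_coe_tan]

end FrechetDerivative

theorem coe_orthogonalProjectionOnto_tan (x : Sph n) (w : Amb n) :
    ((Tan x).orthogonalProjectionOnto w : Amb n) = w - ⟪(x : Amb n), w⟫ • (x : Amb n) := by
  have hproj := Submodule.starProjection_orthogonal_val (K := Submodule.span ℝ {(x : Amb n)}) w
  rw [Submodule.starProjection_apply, Submodule.starProjection_singleton] at hproj
  simpa [norm_eq_of_mem_sphere x] using hproj

theorem finrank_tan (x : Sph n) : Module.finrank ℝ (Tan x) = n :=
  have := Fact.mk (finrank_euclideanSpace_fin (𝕜 := ℝ) (n := n + 1))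
  Submodule.finrank_orthogonal_span_singleton (coe_ne_zero x)

theorem trace_orthogonalProjectionOnto_tan_comp (x : Sph n) (T : Amb n →ₗ[ℝ] Amb n) :
    LinearMap.trace ℝ (Tan x)
        (((Tan x).orthogonalProjectionOnto : Amb n →ₗ[ℝ] Tan x) ∘ₗ T ∘ₗ (Tan x).subtype) =
      LinearMap.trace ℝ (Amb n) T - ⟪(x : Amb n), T x⟫ := by
  have hcomp : (T ∘ₗ (Tan x).subtype) ∘ₗ ((Tan x).orthogonalProjectionOnto : Amb n →ₗ[ℝ] Tan x) =
      T - (innerₗ (Amb n) (x : Amb n)).smulRight (T x) := by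
    ext1 w
    simp only [LinearMap.comp_apply, ContinuousLinearMap.coe_coe, Submodule.subtype_apply,
      coe_orthogonalProjectionOnto_tan, map_sub, map_smul, LinearMap.sub_apply,
      LinearMap.smulRight_apply, innerₗ_apply_apply]
  rw [LinearMap.trace_comp_comm', hcomp, map_sub, LinearMap.trace_smulRight, innerₗ_apply_apply]

section RestrictToSphere

variable {F : Amb n → ℝ} (hF : ∀ z : Sph n, ContDiffAt ℝ ∞ F z)
include hF

theorem contMDiff_comp_coe : ContMDiff (𝓡 n) 𝓘(ℝ) ∞ (fun z : Sph n => F z) := by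
  have := Fact.mk (finrank_euclideanSpace_fin (𝕜 := ℝ) (n := n + 1))
  exact fun z => (hF z).contMDiffAt.comp z (contMDiff_coe_sphere z)

theorem coe_grad_comp_coe (z : Sph n) :
    (grad (fun z : Sph n => F z) z : Amb n) = ∇ F z - fderiv ℝ F z z • (z : Amb n) := by
  rw [coe_grad (contMDiff_comp_coe hF),
    fderiv_comp_coe_radial ((hF z).differentiableAt (by simp))]
  refine ext_inner_right ℝ fun u => ?_
  rw [InnerProductSpace.toDual_symm_apply, inner_sub_left, inner_gradient_left,
    real_inner_smul_left]
  simp [mul_comm]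

theorem covDeriv_grad_comp_coe (x : Sph n) :
    (covDeriv (grad fun z : Sph n => F z) x : Tan x →ₗ[ℝ] Tan x) =
      ((Tan x).orthogonalProjectionOnto : Amb n →ₗ[ℝ] Tan x) ∘ₗ
          (fderiv ℝ (∇ F) x : Amb n →ₗ[ℝ] Amb n) ∘ₗ (Tan x).subtype -
        fderiv ℝ F x x • LinearMap.id := by
  have hFx : ContDiffAt ℝ 2 F x := (hF x).of_le (by norm_cast)
  have hgrad := (hasFDerivAt_gradient hFx).differentiableAt.hasFDerivAt
  have hid := hasFDerivAt_id (𝕜 := ℝ) (x : Amb n)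
  have hfield := hgrad.sub (((hasFDerivAt_fderiv hFx).clm_apply hid).smul hid)
  refine LinearMap.ext fun w => ?_
  have hdSph : dSph (fun z : Sph n => (grad (fun z : Sph n => F z) z : Amb n)) x w =
      fderiv ℝ (∇ F) x w - (fderiv ℝ F x x • (w : Amb n) +
        (fderiv ℝ (fderiv ℝ F) x w x + fderiv ℝ F x w) • (x : Amb n)) := by
    rw [funext (coe_grad_comp_coe hF)]
    refine (dSph_comp_coe_apply hfield.differentiableAt w).trans ?_
    rw [hfield.fderiv]
    simp [add_comm]
  have hproj : (Tan x).orthogonalProjectionOnto (x : Amb n) = 0 :=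
    Submodule.orthogonalProjectionOnto_eq_zero_iff.2
      (Submodule.le_orthogonal_orthogonal _ (Submodule.mem_span_singleton_self _))
  change (Tan x).orthogonalProjectionOnto (dSph _ x w) = _
  rw [hdSph, map_sub, map_add, map_smul, map_smul, hproj,
    Submodule.orthogonalProjectionOnto_mem_subspace_eq_self]
  simp

theorem laplace_comp_coe (x : Sph n) :
    laplace (fun z : Sph n => F z) x =
      -Δ F x + fderiv ℝ (fderiv ℝ F) x x x + n * fderiv ℝ F x x := by
  have hFx : ContDiffAt ℝ 2 F x := (hF x).of_le (by norm_cast)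
  rw [laplace, divg, covDeriv_grad_comp_coe hF, map_sub, map_smul, LinearMap.trace_id,
    trace_orthogonalProjectionOnto_tan_comp]
  have hinner : ⟪(x : Amb n), fderiv ℝ (∇ F) x x⟫ = fderiv ℝ (fderiv ℝ F) x x x := by
    rw [real_inner_comm, inner_fderiv_gradient_left hFx]
  simp only [ContinuousLinearMap.coe_coe, hinner, trace_fderiv_gradient hFx, finrank_tan,
    smul_eq_mul]
  ring

end RestrictToSphere

theorem laplace_comp_coe_of_homogeneous {F : Amb n → ℝ} {d : ℕ}
    (hF : ∀ z : Sph n, ContDiffAt ℝ ∞ F z)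
    (hhom : ∀ y, ∀ t : ℝ, 0 < t → F (t • y) = t ^ d * F y) (x : Sph n) :
    laplace (fun z : Sph n => F z) x = v n d * F x - Δ F x := by
  rw [laplace_comp_coe hF,
    fderiv_apply_self_of_homogeneous ((hF x).differentiableAt (by simp)) (hhom x),
    fderiv_fderiv_apply_self_of_homogeneous ((hF x).of_le (by norm_cast)) hhom, v]
  ring

theorem laplace_eq_neg_laplacian {f : Sph n → ℝ} (hf : ContMDiff (𝓡 n) 𝓘(ℝ) ∞ f) (x : Sph n) :
    laplace f x = -Δ (fun y => f (radial y)) x := by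
  have hdegree := laplace_comp_coe_of_homogeneous (F := fun y => f (radial y)) (d := 0)
    (fun z => contDiffAt_comp_radial hf (coe_ne_zero z)) (fun y t ht => by simp [radial_smul ht]) x
  simpa [radial_coe, v] using hdegree

theorem laplacian_comp_radial {f : Sph n → ℝ} (hf : ContMDiff (𝓡 n) 𝓘(ℝ) ∞ f) {y : Amb n}
    (hy : y ≠ 0) : Δ (fun z => f (radial z)) y = -((‖y‖ ^ 2)⁻¹ * laplace f (radial y)) := by
  have hpos : 0 < ‖y‖⁻¹ := inv_pos.2 (norm_pos_iff.2 hy)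
  have hscale := laplacian_comp_smul (fun z => f (radial z)) ‖y‖⁻¹ y
  simp only [radial_smul hpos] at hscale
  rw [hscale, laplace_eq_neg_laplacian hf, coe_radial hy, inv_pow, mul_neg, neg_neg]

theorem contMDiff_laplace {f : Sph n → ℝ} (hf : ContMDiff (𝓡 n) 𝓘(ℝ) ∞ f) :
    ContMDiff (𝓡 n) 𝓘(ℝ) ∞ (laplace f) := by
  rw [funext (laplace_eq_neg_laplacian hf)]
  exact contMDiff_comp_coe (F := -Δ fun y => f (radial y)) fun z =>
    (contDiffAt_laplacian (contDiffAt_comp_radial hf (coe_ne_zero z))).neg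

/-- The space `C^∞(𝕊^n)`. -/
abbrev SmoothFun (n : ℕ) : Type := C^∞⟮𝓡 n, Sph n; 𝓘(ℝ), ℝ⟯

/-- The Laplace operator `-div grad` as an endomorphism of `C^∞(𝕊^n)`. -/
def laplaceOp (n : ℕ) : SmoothFun n →ₗ[ℝ] SmoothFun n where
  toFun f := ⟨laplace f, contMDiff_laplace f.contMDiff⟩
  map_add' f g := by
    ext x
    exact laplace_add f.contMDiff g.contMDiff x
  map_smul' c f := by
    ext x
    exact laplace_smul f.contMDiff c x

theorem mem_eigenspace_laplaceOp_iff {f : SmoothFun n} {μ : ℝ} :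
    f ∈ End.eigenspace (laplaceOp n) μ ↔ ∀ x, laplace f x = μ * f x := by
  rw [End.mem_eigenspace_iff, DFunLike.ext_iff]
  rfl

/-- The eigenspaces of `laplaceOp`, whose elements are bundled smooth functions, are the spaces
`eigenspace n μ` of plain functions. -/
def eigenspaceLaplaceOpEquiv (n : ℕ) (μ : ℝ) :
    End.eigenspace (laplaceOp n) μ ≃ₗ[ℝ] eigenspace n μ where
  toFun f := ⟨f.1, f.1.contMDiff, mem_eigenspace_laplaceOp_iff.1 f.2⟩
  invFun f := ⟨⟨f.1, f.2.1⟩, mem_eigenspace_laplaceOp_iff.2 f.2.2⟩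
  map_add' _ _ := rfl
  map_smul' _ _ := rfl

theorem mult_eq_toENat_rank (μ : ℝ) :
    mult n μ = Cardinal.toENat (Module.rank ℝ (End.eigenspace (laplaceOp n) μ)) := by
  rw [mult, (eigenspaceLaplaceOpEquiv n μ).rank_eq]

/-! ### Symmetry of the Laplace operator -/

section Cutoff

variable {E : Type*} [NormedAddCommGroup E]

/-- A bump function centred at `2` and supported in `[1, 3]`, used as a profile for `cutoff`. -/
def bump : ContDiffBump (2 : ℝ) := ⟨1 / 2, 1, by norm_num, by norm_num⟩

/-- A smooth radial function supported in the annulus `1 ≤ ‖y‖ ^ 2 ≤ 3`. Multiplying a function of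
the direction `y / ‖y‖` by it gives a test function on the whole space. -/
def cutoff (y : E) : ℝ := bump (‖y‖ ^ 2)

theorem hasCompactSupport_cutoff [ProperSpace E] : HasCompactSupport (cutoff : E → ℝ) :=
  HasCompactSupport.intro (isCompact_closedBall (0 : E) 2) fun y hy => by
    refine bump.zero_of_le_dist ?_
    rw [mem_closedBall_zero_iff, not_le] at hy
    rw [Real.dist_eq, bump]
    exact le_abs.2 (Or.inl (by nlinarith))

theorem cutoff_eventuallyEq_zero : (cutoff : E → ℝ) =ᶠ[nhds 0] 0 := by
  filter_upwards [Metric.ball_mem_nhds (0 : E) one_pos] with y hy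
  refine bump.zero_of_le_dist ?_
  rw [mem_ball_zero_iff] at hy
  rw [Real.dist_eq, bump]
  exact le_abs.2 (Or.inr (by nlinarith [norm_nonneg y]))

variable [InnerProductSpace ℝ E]

theorem contDiff_cutoff : ContDiff ℝ ∞ (cutoff : E → ℝ) :=
  bump.contDiff.comp (contDiff_norm_sq ℝ)

theorem contDiff_cutoff_mul {F : E → ℝ} (hF : ∀ y ≠ 0, ContDiffAt ℝ ∞ F y) :
    ContDiff ℝ ∞ (cutoff * F) := by
  refine contDiff_iff_contDiffAt.2 fun y => ?_
  rcases eq_or_ne y 0 with rfl | hy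
  · refine (contDiffAt_const (c := (0 : ℝ))).congr_of_eventuallyEq ?_
    filter_upwards [cutoff_eventuallyEq_zero] with z hz
    simp [hz]
  · exact contDiff_cutoff.contDiffAt.mul (hF y hy)

theorem gradient_cutoff [CompleteSpace E] (y : E) :
    ∇ cutoff y = (2 * deriv bump (‖y‖ ^ 2)) • y := by
  have hbump : HasDerivAt bump (deriv bump (‖y‖ ^ 2)) (‖y‖ ^ 2) :=
    ((bump.contDiff (n := 1)).differentiable (by simp)).differentiableAt.hasDerivAt
  have hcutoff : fderiv ℝ cutoff y = _ :=
    (hbump.comp_hasFDerivAt y (hasStrictFDerivAt_norm_sq y).hasFDerivAt).fderiv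
  refine ext_inner_right ℝ fun w => ?_
  rw [inner_gradient_left, hcutoff]
  simp only [smul_apply, coe_innerSL_apply, nsmul_eq_mul, Nat.cast_ofNat, smul_eq_mul,
    real_inner_smul_left]
  ring

end Cutoff

/-- The surface measure of `𝕊^n`. -/
abbrev surf (n : ℕ) : Measure (Sph n) := (volume : Measure (Amb n)).toSphere

theorem integral_norm_mul_comp_radial (u : ℝ → ℝ) (h : Sph n → ℝ) :
    ∫ y : Amb n, u ‖y‖ * h (radial y) =
      (∫ r : Set.Ioi (0 : ℝ), u r ∂Measure.volumeIoiPow (Module.finrank ℝ (Amb n) - 1)) *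
        ∫ x, h x ∂surf n := by
  have hpolar (y : ({0}ᶜ : Set (Amb n))) : u ‖(y : Amb n)‖ * h (radial y) =
      h (homeomorphUnitSphereProd (Amb n) y).1 * u (homeomorphUnitSphereProd (Amb n) y).2 := by
    have hdirection : (homeomorphUnitSphereProd (Amb n) y).1 = radial (y : Amb n) :=
      Subtype.ext (by simp [coe_radial y.2])
    rw [hdirection, homeomorphUnitSphereProd_apply_snd_coe, mul_comm]
  calc ∫ y : Amb n, u ‖y‖ * h (radial y)
      = ∫ y : ({0}ᶜ : Set (Amb n)), u ‖(y : Amb n)‖ * h (radial y)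
          ∂(volume.comap (Subtype.val : ({0}ᶜ : Set (Amb n)) → Amb n)) := by
        rw [integral_subtype_comap (measurableSet_singleton _).compl
          fun y : Amb n => u ‖y‖ * h (radial y), restrict_compl_singleton]
    _ = ∫ z, h z.1 * u z.2 ∂((surf n).prod (Measure.volumeIoiPow _)) := by
        simp only [hpolar]
        exact (Measure.measurePreserving_homeomorphUnitSphereProd volume).integral_comp
          (Homeomorph.measurableEmbedding _) fun z => h z.1 * u z.2
    _ = _ := by
        rw [integral_prod_mul h fun r : Set.Ioi (0 : ℝ) => u r, mul_comm]

theorem integral_surf_eq_zero_of_integral_norm_mul {u : ℝ → ℝ} (hu : ∫ y : Amb n, u ‖y‖ ≠ 0)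
    {h : Sph n → ℝ} (hh : ∫ y : Amb n, u ‖y‖ * h (radial y) = 0) : ∫ x, h x ∂surf n = 0 := by
  have hconst := integral_norm_mul_comp_radial (n := n) u 1
  simp only [Pi.one_apply, mul_one] at hconst
  rw [integral_norm_mul_comp_radial] at hh
  exact (mul_eq_zero.1 hh).resolve_left (left_ne_zero_of_mul (hconst ▸ hu))

theorem integral_cutoff_sq_mul_inv_norm_sq_pos :
    0 < ∫ y : Amb n, cutoff y ^ 2 * (‖y‖ ^ 2)⁻¹ := by
  have hcont : Continuous (cutoff * fun y : Amb n => cutoff y * (‖y‖ ^ 2)⁻¹) :=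
    (contDiff_cutoff_mul fun y hy => contDiff_cutoff.contDiffAt.mul
      ((contDiff_norm_sq ℝ).contDiffAt.inv (by simpa using hy))).continuous
  have hpos := hcont.integral_pos_of_hasCompactSupport_nonneg_nonzero (μ := volume)
    (x := √2 • (basePoint n : Amb n)) hasCompactSupport_cutoff.mul_right
    (fun y => mul_nonneg bump.nonneg (mul_nonneg bump.nonneg (by positivity))) (by
      have hnorm : ‖√2 • (basePoint n : Amb n)‖ ^ 2 = 2 := by simp [norm_smul]
      have hbump : bump (2 : ℝ) = 1 := bump.one_of_mem_closedBall (by simp [bump])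
      simp [cutoff, hnorm, hbump])
  simpa only [Pi.mul_apply, ← mul_assoc, ← sq] using hpos

section Symmetry

variable {f g : Sph n → ℝ} (hf : ContMDiff (𝓡 n) 𝓘(ℝ) ∞ f)
include hf

-- The gradients of a radial function and of a function of the direction are orthogonal.
theorem laplacian_cutoff_mul_comp_radial {y : Amb n} (hy : y ≠ 0) :
    Δ (cutoff * fun z => f (radial z) : Amb n → ℝ) y =
      f (radial y) * Δ (cutoff : Amb n → ℝ) y - cutoff y * (‖y‖ ^ 2)⁻¹ * laplace f (radial y) := by
  have hF := contDiffAt_comp_radial hf hy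
  have horth : ⟪∇ cutoff y, ∇ (fun z => f (radial z)) y⟫ = 0 := by
    have hEuler := fderiv_apply_self_of_homogeneous (d := 0) (hF.differentiableAt (by simp))
      fun t ht => by simp [radial_smul ht]
    rw [gradient_cutoff, real_inner_smul_left, inner_gradient_right]
    simp [hEuler]
  rw [laplacian_mul (contDiff_cutoff.contDiffAt.of_le (by norm_cast)) (hF.of_le (by norm_cast)),
    laplacian_comp_radial hf hy, horth]
  ring

theorem integral_mul_laplace_sub_mul_laplace (hg : ContMDiff (𝓡 n) 𝓘(ℝ) ∞ g) :
    ∫ x, (g x * laplace f x - f x * laplace g x) ∂surf n = 0 := by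
  have hsmooth {f : Sph n → ℝ} (hf : ContMDiff (𝓡 n) 𝓘(ℝ) ∞ f) :
      ContDiff ℝ ∞ (cutoff * fun z : Amb n => f (radial z)) :=
    contDiff_cutoff_mul fun _ => contDiffAt_comp_radial hf
  refine integral_surf_eq_zero_of_integral_norm_mul (u := fun r => bump (r ^ 2) ^ 2 * (r ^ 2)⁻¹)
    integral_cutoff_sq_mul_inv_norm_sq_pos.ne' (Eq.trans (integral_congr_ae ?_)
      (integral_mul_laplacian_sub_mul_laplacian (hsmooth hf) hasCompactSupport_cutoff.mul_right
        (hsmooth hg) hasCompactSupport_cutoff.mul_right))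
  filter_upwards [Measure.ae_ne volume (0 : Amb n)] with y hy
  rw [laplacian_cutoff_mul_comp_radial hf hy, laplacian_cutoff_mul_comp_radial hg hy]
  simp only [Pi.mul_apply, cutoff]
  ring

end Symmetry

theorem integrable_mul (f g : SmoothFun n) : Integrable (fun x => f x * g x) (surf n) :=
  (f.contMDiff.continuous.mul g.contMDiff.continuous).integrable_of_hasCompactSupport
    (HasCompactSupport.of_compactSpace _)

/-- The inner product of `L²(𝕊^n)`, for which `C^∞(𝕊^n)` is not complete. -/
scoped instance : InnerProductSpace.Core ℝ (SmoothFun n) where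
  inner f g := ∫ x, f x * g x ∂surf n
  conj_inner_symm f g := by simp only [conj_trivial, mul_comm]
  re_inner_nonneg f := integral_nonneg fun x => mul_self_nonneg (f x)
  add_left f g h := by
    simp only [ContMDiffMap.coe_add, Pi.add_apply, add_mul]
    exact integral_add (integrable_mul f h) (integrable_mul g h)
  smul_left f g c := by
    simp only [ContMDiffMap.coe_smul, Pi.smul_apply, smul_eq_mul, mul_assoc, integral_const_mul,
      conj_trivial]
  definite f hf := by
    have hcont : Continuous fun x => f x * f x := f.contMDiff.continuous.mul f.contMDiff.continuous
    have hae := (integral_eq_zero_iff_of_nonneg (fun x => mul_self_nonneg (f x))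
      (integrable_mul f f)).1 hf
    have hsq := (hcont.ae_eq_iff_eq _ continuous_zero).1 hae
    ext x
    exact mul_self_eq_zero.1 (congrFun hsq x)

scoped instance : NormedAddCommGroup (SmoothFun n) :=
  InnerProductSpace.Core.toNormedAddCommGroup (𝕜 := ℝ)

scoped instance : InnerProductSpace ℝ (SmoothFun n) := .ofCore inferInstance

theorem inner_eq_integral (f g : SmoothFun n) : ⟪f, g⟫ = ∫ x, f x * g x ∂surf n :=
  rfl

theorem isSymmetric_laplaceOp : (laplaceOp n).IsSymmetric := by
  intro f g
  have hgreen := integral_mul_laplace_sub_mul_laplace f.contMDiff g.contMDiff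
  have hsub := integral_sub (integrable_mul g (laplaceOp n f)) (integrable_mul f (laplaceOp n g))
  rw [inner_eq_integral, inner_eq_integral]
  simpa only [mul_comm] using sub_eq_zero.1 (hsub.symm.trans hgreen)

/-! ### Polynomial functions on the sphere -/

/-- The restriction to `𝕊^n` of the `i`-th coordinate of `ℝ^{n+1}`. -/
def coord (i : Fin (n + 1)) : SmoothFun n :=
  ⟨fun x => (x : Amb n) i,
    contMDiff_comp_coe fun _ => (EuclideanSpace.proj (𝕜 := ℝ) i).contDiff.contDiffAt⟩

/-- Restriction of polynomials on `ℝ^{n+1}` to `𝕊^n`. -/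
def restrict (n : ℕ) : MvPolynomial (Fin (n + 1)) ℝ →ₐ[ℝ] SmoothFun n := aeval coord

theorem restrict_X (i : Fin (n + 1)) : restrict n (X i) = coord i :=
  aeval_X _ _

theorem restrict_apply (P : MvPolynomial (Fin (n + 1)) ℝ) (x : Sph n) :
    restrict n P x = eval (x : Amb n).ofLp P := by
  induction P using MvPolynomial.induction_on with
  | C a =>
    rw [eval_C, ← algebraMap_eq, (restrict n).commutes]
    rfl
  | add P Q hP hQ => simp [hP, hQ]
  | mul_X P i hP =>
    simp only [map_mul, eval_X, ContMDiffMap.coe_mul, Pi.mul_apply, hP, restrict_X]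
    rfl

theorem laplaceOp_restrict {P : MvPolynomial (Fin (n + 1)) ℝ} {d : ℕ} (hP : P.IsHomogeneous d) :
    laplaceOp n (restrict n P) = v n d • restrict n P - restrict n (polyLaplacian P) := by
  ext x
  have hhom (y : Amb n) (t : ℝ) (_ : 0 < t) : eval (t • y).ofLp P = t ^ d * eval y.ofLp P :=
    eval_smul_of_isHomogeneous hP t y.ofLp
  have hlaplace := laplace_comp_coe_of_homogeneous (fun z => (contDiff_eval P).contDiffAt) hhom x
  rw [laplacian_eval] at hlaplace
  simp only [← restrict_apply] at hlaplace
  exact hlaplace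

/-- Restrictions to `𝕊^n` of the homogeneous polynomials of degree `d` on `ℝ^{n+1}`. -/
def homPolySphere (n d : ℕ) : Submodule ℝ (SmoothFun n) :=
  (homogeneousSubmodule (Fin (n + 1)) ℝ d).map (restrict n).toLinearMap

/-- Restrictions to `𝕊^n` of the polynomials of degree less than `k` on `ℝ^{n+1}`. -/
def polySphere (n k : ℕ) : Submodule ℝ (SmoothFun n) :=
  ⨆ d, ⨆ _ : d < k, homPolySphere n d

theorem mem_homPolySphere {d : ℕ} {f : SmoothFun n} :
    f ∈ homPolySphere n d ↔ ∃ P, P.IsHomogeneous d ∧ restrict n P = f :=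
  Iff.rfl

theorem restrict_mem_homPolySphere {d : ℕ} {P : MvPolynomial (Fin (n + 1)) ℝ}
    (hP : P.IsHomogeneous d) : restrict n P ∈ homPolySphere n d :=
  ⟨P, hP, rfl⟩

theorem homPolySphere_le_polySphere {d k : ℕ} (hd : d < k) : homPolySphere n d ≤ polySphere n k :=
  le_iSup₂_of_le d hd le_rfl

theorem polySphere_zero : polySphere n 0 = ⊥ := by
  simp [polySphere]

theorem polySphere_mono : Monotone (polySphere n) := fun _ _ hjk =>
  iSup₂_le fun _ hd => homPolySphere_le_polySphere (hd.trans_le hjk)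

theorem polySphere_succ (k : ℕ) : polySphere n (k + 1) = polySphere n k ⊔ homPolySphere n k := by
  refine le_antisymm (iSup₂_le fun d hd => ?_)
    (sup_le (polySphere_mono k.le_succ) (homPolySphere_le_polySphere k.lt_succ_self))
  rcases Nat.lt_succ_iff_lt_or_eq.1 hd with hlt | rfl
  · exact le_sup_of_le_left (homPolySphere_le_polySphere hlt)
  · exact le_sup_right

theorem laplaceOp_sub_smul_mem_polySphere {d : ℕ} {f : SmoothFun n} (hf : f ∈ homPolySphere n d) :
    laplaceOp n f - v n d • f ∈ polySphere n d := by
  obtain ⟨P, hP, rfl⟩ := mem_homPolySphere.1 hf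
  rw [laplaceOp_restrict hP, sub_sub_cancel_left]
  refine neg_mem ?_
  rcases lt_or_ge d 2 with hd | hd
  · rw [polyLaplacian_eq_zero hP hd, map_zero]
    exact zero_mem _
  · exact homPolySphere_le_polySphere (by lia)
      (restrict_mem_homPolySphere (isHomogeneous_polyLaplacian hP))

theorem isTriangularFiltration_polySphere :
    IsTriangularFiltration (laplaceOp n) (polySphere n) (v n) where
  zero := polySphere_zero
  mono := polySphere_mono
  sub_smul_mem k f hf := by
    suffices hle : polySphere n (k + 1) ≤
        (polySphere n k).comap (laplaceOp n - v n k • LinearMap.id) from hle hf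
    refine iSup₂_le fun d hd f hf => ?_
    change laplaceOp n f - v n k • f ∈ polySphere n k
    have hsplit : laplaceOp n f - v n k • f =
        (laplaceOp n f - v n d • f) + (v n d - v n k) • f := by
      rw [sub_smul]
      abel
    rw [hsplit]
    refine add_mem
      (polySphere_mono (Nat.lt_succ_iff.1 hd) (laplaceOp_sub_smul_mem_polySphere hf)) ?_
    rcases Nat.lt_succ_iff_lt_or_eq.1 hd with hlt | rfl
    · exact Submodule.smul_mem _ _ (homPolySphere_le_polySphere hlt hf)
    · simp

theorem restrict_mem_iSup_polySphere (P : MvPolynomial (Fin (n + 1)) ℝ) :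
    restrict n P ∈ ⨆ k, polySphere n k := by
  rw [← P.sum_homogeneousComponent, map_sum]
  exact sum_mem fun d _ => Submodule.mem_iSup_of_mem (d + 1) (homPolySphere_le_polySphere
    d.lt_succ_self (restrict_mem_homPolySphere (homogeneousComponent_isHomogeneous d P)))

/-- Smooth functions as continuous functions. -/
def toContinuousMap (n : ℕ) : SmoothFun n →ₐ[ℝ] C(Sph n, ℝ) where
  toFun f := ⟨f, f.contMDiff.continuous⟩
  map_one' := rfl
  map_mul' _ _ := rfl
  map_zero' := rfl
  map_add' _ _ := rfl
  commutes' _ := rfl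

theorem topologicalClosure_range_restrict :
    ((toContinuousMap n).comp (restrict n)).range.topologicalClosure = ⊤ := by
  refine ContinuousMap.subalgebra_topologicalClosure_eq_top_of_separatesPoints _ fun x y hxy => ?_
  obtain ⟨i, hi⟩ : ∃ i, (x : Amb n) i ≠ (y : Amb n) i := by
    by_contra! hcoord
    exact hxy (Subtype.ext (PiLp.ext hcoord))
  refine ⟨_, ⟨_, ⟨X i, rfl⟩, rfl⟩, fun heq => hi ?_⟩
  have hrestrict : restrict n (X i) x = restrict n (X i) y := heq
  simpa only [restrict_apply, eval_X] using hrestrict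

theorem iSup_polySphere_orthogonal : (⨆ k, polySphere n k)ᗮ = ⊥ := by
  rw [eq_bot_iff]
  intro f hf
  let J : C(Sph n, ℝ) →L[ℝ] Lp ℝ 2 (surf n) := ContinuousMap.toLp 2 (surf n) ℝ
  have hJ (g h : SmoothFun n) : ⟪J (toContinuousMap n g), J (toContinuousMap n h)⟫ = ⟪g, h⟫ :=
    (ContinuousMap.inner_toLp (𝕜 := ℝ) (surf n) _ _).trans <|
      (integral_congr_ae (.of_forall fun x => mul_comm _ _)).trans (inner_eq_integral g h).symm
  have hclosed : IsClosed {a : C(Sph n, ℝ) | ⟪J a, J (toContinuousMap n f)⟫ = 0} :=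
    isClosed_eq (J.continuous.inner continuous_const) continuous_const
  have hrange : (((toContinuousMap n).comp (restrict n)).range : Set C(Sph n, ℝ)) ⊆
      {a | ⟪J a, J (toContinuousMap n f)⟫ = 0} := by
    rintro _ ⟨P, rfl⟩
    exact (hJ _ _).trans ((Submodule.mem_orthogonal _ _).1 hf _ (restrict_mem_iSup_polySphere P))
  have hmem : toContinuousMap n f ∈
      ((toContinuousMap n).comp (restrict n)).range.topologicalClosure := by
    rw [topologicalClosure_range_restrict]
    trivial
  exact inner_self_eq_zero.1 ((hJ f f).symm.trans (closure_minimal hrange hclosed hmem))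

instance (d : ℕ) : FiniteDimensional ℝ (homPolySphere n d) :=
  have : FiniteDimensional ℝ (homogeneousSubmodule (Fin (n + 1)) ℝ d) :=
    Module.Finite.iff_fg.2 (homogeneousSubmodule_fg _ _ d)
  (Module.Finite.map _ _ :
    FiniteDimensional ℝ ((homogeneousSubmodule (Fin (n + 1)) ℝ d).map (restrict n).toLinearMap))

instance (k : ℕ) : FiniteDimensional ℝ (polySphere n k) := by
  induction k with
  | zero => rw [polySphere_zero]; infer_instance
  | succ k ih => rw [polySphere_succ]; infer_instance

theorem restrict_sum_X_sq : restrict n (∑ i, X i ^ 2) = 1 := by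
  ext x
  have hnorm : ∑ i, (x : Amb n) i ^ 2 = 1 := by
    rw [← EuclideanSpace.real_norm_sq_eq, norm_eq_of_mem_sphere, one_pow]
  rw [restrict_apply]
  simpa only [map_sum, map_pow, eval_X] using! hnorm

theorem homPolySphere_le_add_two (d : ℕ) : homPolySphere n d ≤ homPolySphere n (d + 2) := by
  rintro _ ⟨P, hP, rfl⟩
  refine mem_homPolySphere.2 ⟨P * ∑ i, X i ^ 2, hP.mul (isHomogeneous_sum_X_sq ℝ), ?_⟩
  rw [map_mul, restrict_sum_X_sq, mul_one]
  rfl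

theorem polySphere_add_two (k : ℕ) :
    polySphere n (k + 2) = homPolySphere n (k + 1) ⊔ homPolySphere n k := by
  induction k with
  | zero => simp [polySphere_succ, polySphere_zero, sup_comm]
  | succ k ih =>
    rw [polySphere_succ, ih, sup_right_comm, sup_assoc, sup_eq_left.2 (homPolySphere_le_add_two k),
      sup_comm]

theorem eq_zero_of_restrict_eq_zero {P : MvPolynomial (Fin (n + 1)) ℝ} {d : ℕ}
    (hP : P.IsHomogeneous d) (hzero : restrict n P = 0) : P = 0 := by
  refine hP.eq_zero_of_forall_eval_eq_zero fun y => ?_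
  have hy : ‖(WithLp.toLp 2 y : Amb n)‖ • (radial (WithLp.toLp 2 y) : Amb n).ofLp = y :=
    congrArg WithLp.ofLp (norm_smul_radial _)
  rw [← hy, eval_smul_of_isHomogeneous hP, ← restrict_apply, hzero]
  exact mul_zero _

theorem finrank_homPolySphere (d : ℕ) : finrank ℝ (homPolySphere n d) = (n + d).choose n := by
  have hinj : Function.Injective
      ((restrict n).toLinearMap.domRestrict (homogeneousSubmodule (Fin (n + 1)) ℝ d)) :=
    (injective_iff_map_eq_zero _).2 fun P hzero =>
      Subtype.ext (eq_zero_of_restrict_eq_zero P.2 hzero)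
  rw [homPolySphere, ← LinearMap.range_domRestrict, LinearMap.finrank_range_of_inj hinj,
    finrank_homogeneousSubmodule, Fintype.card_fin, Nat.multichoose_eq, Nat.add_right_comm,
    Nat.add_sub_cancel, Nat.choose_symm_add]

theorem apply_neg_of_mem_homPolySphere {d : ℕ} {f : SmoothFun n} (hf : f ∈ homPolySphere n d)
    (x : Sph n) : f (-x) = (-1) ^ d * f x := by
  obtain ⟨P, hP, rfl⟩ := mem_homPolySphere.1 hf
  rw [restrict_apply, restrict_apply, ← eval_smul_of_isHomogeneous hP]
  simp

theorem disjoint_homPolySphere_succ (d : ℕ) :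
    Disjoint (homPolySphere n (d + 1)) (homPolySphere n d) := by
  refine Submodule.disjoint_def.2 fun f hodd heven => ?_
  ext x
  have hparity := (apply_neg_of_mem_homPolySphere hodd x).symm.trans
    (apply_neg_of_mem_homPolySphere heven x)
  rw [pow_succ, mul_assoc, neg_one_mul] at hparity
  exact self_eq_neg.1 (mul_left_cancel₀ (pow_ne_zero d (by simp)) hparity).symm

theorem finrank_polySphere_succ (hn : 0 < n) (k : ℕ) :
    finrank ℝ (polySphere n (k + 1)) = (n + k).choose n + (n + k - 1).choose n := by
  cases k with
  | zero =>
    rw [polySphere_succ, polySphere_zero, bot_sup_eq, finrank_homPolySphere,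
      Nat.choose_eq_zero_of_lt (n := n + 0 - 1) (by lia)]
    rfl
  | succ k =>
    have hdim := Submodule.finrank_sup_add_finrank_inf_eq (homPolySphere n (k + 1))
      (homPolySphere n k)
    rwa [(disjoint_homPolySphere_succ k).eq_bot, finrank_bot, add_zero, ← polySphere_add_two,
      finrank_homPolySphere, finrank_homPolySphere] at hdim

/-! ### The counting function and the Weyl function -/

theorem tsum_subtype_Iic_eq_sum_range {α M : Type*} [LinearOrder α] [AddCommMonoid M]
    [TopologicalSpace M] {c : ℕ → α} (hc : StrictMono c) {m : α → M}
    (hm : ∀ a, (∀ j, c j ≠ a) → m a = 0) (k : ℕ) :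
    ∑' a : Set.Iic (c k), m a = ∑ j ∈ Finset.range (k + 1), m (c j) := by
  classical
  rw [tsum_subtype, tsum_eq_sum (s := (Finset.range (k + 1)).image c),
    Finset.sum_image hc.injective.injOn]
  · refine Finset.sum_congr rfl fun j hj => Set.indicator_of_mem ?_ m
    exact hc.monotone (Nat.lt_succ_iff.1 (Finset.mem_range.1 hj))
  · refine fun a ha => Set.indicator_apply_eq_zero.2 fun hle => hm a ?_
    rintro j rfl
    exact ha <| Finset.mem_image_of_mem c <|
      Finset.mem_range.2 (Nat.lt_succ_iff.2 (hc.le_iff_le.1 hle))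

theorem v_strictMono (hn : 0 < n) : StrictMono (v n) := by
  refine strictMono_nat_of_lt_succ fun k => ?_
  have hn' : (1 : ℝ) ≤ n := by exact_mod_cast hn
  simp only [v]
  push_cast
  nlinarith

theorem mult_v (hn : 0 < n) (k : ℕ) :
    mult n (v n k) = finrank ℝ (End.eigenspace (laplaceOp n) (v n k)) := by
  have hle : End.eigenspace (laplaceOp n) (v n k) ≤ polySphere n (k + 1) :=
    isTriangularFiltration_polySphere.eigenspace_le isSymmetric_laplaceOp
      iSup_polySphere_orthogonal fun j hj => (v_strictMono hn hj).ne'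
  have := Submodule.finiteDimensional_of_le hle
  rw [mult_eq_toENat_rank, ← finrank_eq_rank, Cardinal.toENat_nat]

theorem mult_eq_zero {μ : ℝ} (hμ : ∀ j, v n j ≠ μ) : mult n μ = 0 := by
  rw [mult_eq_toENat_rank, isTriangularFiltration_polySphere.eigenspace_eq_bot
    isSymmetric_laplaceOp iSup_polySphere_orthogonal hμ, rank_bot, map_zero]

theorem counting_v (hn : 0 < n) (k : ℕ) :
    counting n (v n k) = ((n + k).choose n + (n + k - 1).choose n : ℕ) := by
  rw [counting, tsum_subtype_Iic_eq_sum_range (v_strictMono hn) fun _ => mult_eq_zero,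
    ← finrank_polySphere_succ hn, isTriangularFiltration_polySphere.finrank_eq_sum
      isSymmetric_laplaceOp iSup_polySphere_orthogonal (v_strictMono hn).injective, Nat.cast_sum]
  exact Finset.sum_congr rfl fun j _ => mult_v hn j

theorem ballVolume_eq (hn : 0 < n) :
    ballVolume n = √Real.pi ^ n / Real.Gamma ((n : ℝ) / 2 + 1) := by
  have : Nonempty (Fin n) := ⟨⟨0, hn⟩⟩
  rw [ballVolume, EuclideanSpace.volume_ball, ENNReal.ofReal_one, one_pow, one_mul,
    Fintype.card_fin]
  exact ENNReal.toReal_ofReal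
    (div_nonneg (by positivity) (Real.Gamma_pos_of_pos (by positivity)).le)

theorem sphereVolume_eq (n : ℕ) : sphereVolume n = (n + 1) * ballVolume (n + 1) := by
  rw [sphereVolume, MeasureTheory.Measure.toSphere_apply_univ, ENNReal.toReal_mul, ballVolume,
    finrank_euclideanSpace_fin, ENNReal.toReal_natCast, Nat.cast_succ]

theorem Gamma_half_add_one_mul_Gamma_half_add_one (n : ℕ) :
    Real.Gamma ((n : ℝ) / 2 + 1) * Real.Gamma (((n + 1 : ℕ) : ℝ) / 2 + 1) =
      (n + 1).factorial * √Real.pi / 2 ^ (n + 1) := by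
  have hdup := Real.Gamma_mul_Gamma_add_half ((n : ℝ) / 2 + 1)
  have htwice : 2 * ((n : ℝ) / 2 + 1) = ((n + 1 : ℕ) : ℝ) + 1 := by
    push_cast
    ring
  have hshift : (n : ℝ) / 2 + 1 + 1 / 2 = ((n + 1 : ℕ) : ℝ) / 2 + 1 := by
    push_cast
    ring
  rw [htwice, hshift, Real.Gamma_nat_eq_factorial, sub_add_cancel_right, Real.rpow_neg (by simp),
    Real.rpow_natCast] at hdup
  rw [hdup]
  ring

theorem weyl_eq (hn : 0 < n) {x : ℝ} (hx : 0 ≤ x) : weyl n x = 2 / n.factorial * √x ^ n := by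
  have hGamma := Gamma_half_add_one_mul_Gamma_half_add_one n
  have hπ : Real.pi ^ n = √Real.pi ^ n * √Real.pi ^ n := by
    rw [← mul_pow, Real.mul_self_sqrt Real.pi_pos.le]
  have hvolumes : ballVolume n / (2 * Real.pi) ^ n * sphereVolume n =
      (n + 1) * √Real.pi / (2 ^ n * (Real.Gamma ((n : ℝ) / 2 + 1) *
        Real.Gamma (((n + 1 : ℕ) : ℝ) / 2 + 1))) := by
    rw [sphereVolume_eq, ballVolume_eq hn, ballVolume_eq n.succ_pos, mul_pow, hπ, pow_succ]
    field_simp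
  rw [weyl, hvolumes, hGamma, Real.rpow_div_two_eq_sqrt _ hx, Real.rpow_natCast,
    Nat.factorial_succ]
  push_cast
  field_simp
  ring

theorem factorial_mul_choose_add_choose (m k : ℕ) :
    (m + 1).factorial * ((m + 1 + k).choose (m + 1) + (m + 1 + k - 1).choose (m + 1)) =
      (2 * k + m + 1) * (k + 1).ascFactorial m := by
  rw [mul_add, add_comm (m + 1) k, ← Nat.ascFactorial_eq_factorial_mul_choose,
    ← Nat.ascFactorial_eq_factorial_mul_choose', Nat.ascFactorial_succ (n := k),
    ← Nat.succ_ascFactorial, Nat.ascFactorial_succ]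
  ring

theorem toNat_counting_v (m k : ℕ) :
    ((counting (m + 1) (v (m + 1) k)).toNat : ℝ) = 2 / (m + 1).factorial *
      ((k + ((m : ℝ) + 1) / 2) * ∏ i ∈ Finset.range m, ((k : ℝ) + 1 + i)) := by
  have hcount : ((m + 1).factorial : ℝ) *
      ((m + 1 + k).choose (m + 1) + (m + 1 + k - 1).choose (m + 1) : ℕ) =
        (2 * k + m + 1) * ∏ i ∈ Finset.range m, ((k : ℝ) + 1 + i) := by
    exact_mod_cast Nat.ascFactorial_eq_prod_range (k + 1) m ▸ factorial_mul_choose_add_choose m k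
  rw [counting_v m.succ_pos, ENat.toNat_natCast,
    ← mul_right_inj' (Nat.cast_ne_zero.2 (m + 1).factorial_ne_zero), hcount]
  field_simp
  ring

section ProductBounds

theorem sq_prod_add_one_add {R : Type*} [CommRing R] (a : R) (m : ℕ) :
    (∏ i ∈ Finset.range m, (a + 1 + i)) ^ 2 =
      ∏ i ∈ Finset.range m, ((a + 1 + i) * (a + m - i)) := by
  rw [Finset.prod_mul_distrib, pow_two, ← Finset.prod_range_reflect (fun i : ℕ => a + m - i)]
  congr 1
  refine Finset.prod_congr rfl fun i hi => ?_
  rw [Nat.sub_sub, Nat.cast_sub (by have := Finset.mem_range.1 hi; lia)]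
  push_cast
  ring

variable {a : ℝ} (ha : 0 ≤ a) (m : ℕ)
include ha

theorem sqrt_pow_le_prod_add_one_add :
    √(a * (a + m)) ^ m ≤ ∏ i ∈ Finset.range m, (a + 1 + i) := by
  refine le_of_sq_le_sq ?_ (Finset.prod_nonneg fun i _ => by positivity)
  rw [sq_prod_add_one_add, pow_right_comm, Real.sq_sqrt (by positivity), Finset.pow_eq_prod_const]
  refine Finset.prod_le_prod (fun _ _ => by positivity) fun i hi => ?_
  have him : (i : ℝ) + 1 ≤ m := by exact_mod_cast Finset.mem_range.1 hi
  nlinarith [mul_nonneg (by positivity : (0 : ℝ) ≤ i + 1) (by linarith : (0 : ℝ) ≤ m - i)]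

theorem prod_add_one_add_le_pow :
    ∏ i ∈ Finset.range m, (a + 1 + i) ≤ (a + ((m : ℝ) + 1) / 2) ^ m := by
  refine le_of_sq_le_sq ?_ (by positivity)
  rw [sq_prod_add_one_add, pow_right_comm, Finset.pow_eq_prod_const]
  refine Finset.prod_le_prod (fun i hi => ?_) fun i _ => ?_
  · have him : (i : ℝ) + 1 ≤ m := by exact_mod_cast Finset.mem_range.1 hi
    exact mul_nonneg (by positivity) (by linarith)
  · nlinarith [sq_nonneg ((m : ℝ) - 1 - 2 * i)]

end ProductBounds

theorem sqrt_v_pow_lt (m k : ℕ) :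
    √(v (m + 1) k) ^ (m + 1) <
      (k + ((m : ℝ) + 1) / 2) * ∏ i ∈ Finset.range m, ((k : ℝ) + 1 + i) := by
  have hv : v (m + 1) k = k * (k + m) := by
    rw [v]
    push_cast
    ring
  have hsqrt : √(v (m + 1) k) < k + ((m : ℝ) + 1) / 2 := by
    rw [Real.sqrt_lt' (by positivity), hv]
    nlinarith
  calc √(v (m + 1) k) ^ (m + 1) = √(v (m + 1) k) * √(v (m + 1) k) ^ m := pow_succ' _ _
    _ ≤ √(v (m + 1) k) * ∏ i ∈ Finset.range m, ((k : ℝ) + 1 + i) := by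
        gcongr
        exact hv ▸ sqrt_pow_le_prod_add_one_add k.cast_nonneg m
    _ < (k + ((m : ℝ) + 1) / 2) * ∏ i ∈ Finset.range m, ((k : ℝ) + 1 + i) :=
        mul_lt_mul_of_pos_right hsqrt (Finset.prod_pos fun i _ => by positivity)

theorem lt_sqrt_v_succ_pow (m k : ℕ) (hk : ((m + 1 : ℕ) : ℝ) ^ 2 / 4 - (m + 1 : ℕ) < k) :
    (k + ((m : ℝ) + 1) / 2) * ∏ i ∈ Finset.range m, ((k : ℝ) + 1 + i) <
      √(v (m + 1) (k + 1)) ^ (m + 1) := by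
  have hsqrt : k + ((m : ℝ) + 1) / 2 < √(v (m + 1) (k + 1)) := by
    rw [Real.lt_sqrt (by positivity), v]
    push_cast at hk ⊢
    linarith
  calc (k + ((m : ℝ) + 1) / 2) * ∏ i ∈ Finset.range m, ((k : ℝ) + 1 + i)
      ≤ (k + ((m : ℝ) + 1) / 2) * (k + ((m : ℝ) + 1) / 2) ^ m := by
        gcongr
        exact prod_add_one_add_le_pow k.cast_nonneg m
    _ = (k + ((m : ℝ) + 1) / 2) ^ (m + 1) := (pow_succ' _ _).symm
    _ < √(v (m + 1) (k + 1)) ^ (m + 1) := by gcongr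

theorem v_nonneg (hn : 0 < n) (k : ℕ) : 0 ≤ v n k := by
  simpa [v] using (v_strictMono hn).monotone k.zero_le

end RoundSphere

end

theorem mainTheorem2 (n : ℕ) (hn : 0 < n) :
    (∀ k : ℕ, RoundSphere.counting n (RoundSphere.v n k) ≠ ⊤ ∧
      RoundSphere.weyl n (RoundSphere.v n k) <
        ((RoundSphere.counting n (RoundSphere.v n k)).toNat : ℝ)) ∧
    (∀ k : ℕ, (n : ℝ) ^ 2 / 4 - (n : ℝ) < (k : ℝ) →
      ((RoundSphere.counting n (RoundSphere.v n k)).toNat : ℝ) <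
        RoundSphere.weyl n (RoundSphere.v n (k + 1))) := by
  obtain ⟨m, rfl⟩ := Nat.exists_eq_add_one.2 hn
  have hpos : (0 : ℝ) < 2 / (m + 1).factorial := by positivity
  refine ⟨fun k => ⟨?_, ?_⟩, fun k hk => ?_⟩
  · rw [RoundSphere.counting_v hn]
    exact ENat.natCast_ne_top _
  · rw [RoundSphere.weyl_eq hn (RoundSphere.v_nonneg hn k), RoundSphere.toNat_counting_v]
    exact mul_lt_mul_of_pos_left (RoundSphere.sqrt_v_pow_lt m k) hpos
  · rw [RoundSphere.weyl_eq hn (RoundSphere.v_nonneg hn _), RoundSphere.toNat_counting_v]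
    exact mul_lt_mul_of_pos_left (RoundSphere.lt_sqrt_v_succ_pow m k hk) hpos
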